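/- Let $K$ be a field, let $n \ge 1$, and let $G$ be a finite simple connected graph on the vertex set $[n]=\{1,\dots,n\}$. Let $G^*$ be its whisker graph, i.e. the graph on the vertex set $\{1,\dots,n\}\cup\{1',\dots,n'\}$ with edge set $E(G)\cup\{\{1,1'\},\dots,\{n,n'\}\}$. Let $S^*=K[x_1,\dots,x_n,y_1,\dots,y_n]$, and let $$I(G^*)=\bigl(x_ix_j : \{i,j\}\in E(G)\bigr)+\bigl(x_iy_i : 1\le i\le n\bigr)\subset S^*$$ be the edge ideal of $G^*$. Then $$\operatorname{depth}\bigl(S^*/I(G^*)^k\bigr)\le n-k+1\qquad\text{for } k=1,\dots,n,$$ where the depth of $S^*/I(G^*)^k$ is the supremum of the lengths of the $S^*/I(G^*)^k$-regular sequences contained in the graded maximal ideal $(x_1,\dots,x_n,y_1,\dots,y_n)$ of $S^*$. -/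

import Mathlib

/-- The whisker graph of `G`: its vertices are the vertices `inl i` of `G` together with a new
vertex `inr i` for every vertex `i` of `G`, and its edges are the edges of `G` together with the
whiskers joining `inl i` to `inr i`. -/
def whiskerGraph {V : Type*} (G : SimpleGraph V) : SimpleGraph (V ⊕ V) where
  Adj
    | .inl i, .inl j => G.Adj i j
    | .inl i, .inr j => i = j
    | .inr i, .inl j => i = j
    | .inr _, .inr _ => False
  symm := ⟨by
    rintro (i | i) (j | j) h
    · exact G.adj_symm h
    · exact Eq.symm h
    · exact Eq.symm h
    · exact h⟩
  loopless := ⟨by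
    rintro (i | i) h
    · exact G.irrefl h
    · exact h⟩

/-- The edge ideal of a graph on `V`, in the polynomial ring over `K` with one variable for each
vertex: it is generated by the products of the two variables of each edge. -/
noncomputable def edgeIdeal (K : Type*) [Field K] {V : Type*} (G : SimpleGraph V) :
    Ideal (MvPolynomial V K) :=
  Ideal.span {f | ∃ i j : V, G.Adj i j ∧ f = MvPolynomial.X i * MvPolynomial.X j}

/-- The graded maximal ideal of a polynomial ring, generated by all the variables. -/
noncomputable def gradedMaximalIdeal (K : Type*) [Field K] (V : Type*) : Ideal (MvPolynomial V K) :=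
  Ideal.span (Set.range (MvPolynomial.X : V → MvPolynomial V K))

/-- The depth of `M` with respect to the ideal `I`: the supremum of the lengths of the `M`-regular
sequences with all their elements in `I`, for modules with `I M ≠ M`. -/
noncomputable def depthIn {R : Type*} [CommRing R] (I : Ideal R)
    (M : Type*) [AddCommGroup M] [Module R M] : ℕ∞ :=
  ⨆ rs ∈ {rs : List R | (∀ r ∈ rs, r ∈ I) ∧ RingTheory.Sequence.IsRegular M rs},
    (rs.length : ℕ∞)

/-- The depth of a module over a polynomial ring over a field, in the graded sense: the depth with
respect to the graded maximal ideal. -/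
noncomputable def polyDepth (K : Type*) [Field K] (V : Type*)
    (M : Type*) [AddCommGroup M] [Module (MvPolynomial V K) M] : ℕ∞ :=
  depthIn (gradedMaximalIdeal K V) M

open CategoryTheory Abelian MvPolynomial

universe u v

/-! Write `S` for the ring and `J = I(G*)^k`. Growing a tree in the connected graph `G` gives `k`
vertices, 2-coloured as `A ∪ B`, and the product `e` of its `k - 1` edges. Let `f` be the product of
the `y_j` with `j ∉ A ∪ B`, and `D` the set of these `n - k` variables. The other variables split
into `U` and `V` with `u * v * f * e ∈ J` for `u ∈ U`, `v ∈ V` (`IsLinkMonomial`). Put `P = (U) +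
(V)`. Since `(U) ∩ (V)` times `f * e` lies in `J`, there is a map `P → S/J` equal to multiplication
by `f * e` on `(U)` and to zero on `(V)`. A weight argument (`coeff_eq_zero_of_mem_pow`) shows that
no multiple of it by a polynomial with nonzero constant term is multiplication by an element. So
`Ext¹(S/P, S/J)` is nonzero at the graded maximal ideal, and Ischebeck's theorem gives depth at most
`dim S/P + 1 = n - k + 1`. Localisation is replaced by annihilators with nonzero constant term. -/

/-- If multiplication by `s` on a finite module has image in the multiples of `y`, and `χ` is a
ring homomorphism to a domain killing `y` but not `s`, then the module is killed by an element
outside the kernel of `χ`. -/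
lemma exists_smul_eq_zero_of_smul_eq_smul {R F E : Type*} [CommRing R] [CommRing F] [IsDomain F]
    [AddCommGroup E] [Module R E] [Module.Finite R E] (χ : R →+* F) {y s : R} (hy : χ y = 0)
    (hs : χ s ≠ 0) (h : ∀ e : E, ∃ e' : E, s • e = y • e') :
    ∃ t : R, χ t ≠ 0 ∧ ∀ e : E, t • e = 0 := by
  obtain ⟨p, hp, -, hcoeff, hzero⟩ :=
    LinearMap.exists_monic_and_natDegree_eq_and_coeff_mem_pow_and_aeval_eq_zero R
      (algebraMap R (Module.End R E) s) (Ideal.span {y}) (by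
        rintro _ ⟨e, rfl⟩
        obtain ⟨e', he'⟩ := h e
        rw [Module.algebraMap_end_apply, he']
        exact Submodule.smul_mem_smul (Ideal.mem_span_singleton_self y) trivial)
  -- The lower coefficients of the monic `p` are multiples of `y`, so `χ` sends `p.eval s` to a
  -- power of `χ s`.
  refine ⟨p.eval s, ?_, fun e ↦ ?_⟩
  · have hmap : p.map χ = Polynomial.X ^ p.natDegree := by
      ext i
      rw [Polynomial.coeff_map, Polynomial.coeff_X_pow]
      rcases lt_trichotomy i p.natDegree with hi | rfl | hi
      · rw [if_neg hi.ne]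
        have h1 := Ideal.pow_le_self (Nat.sub_ne_zero_of_lt hi) (hcoeff i)
        obtain ⟨c, hc⟩ := Ideal.mem_span_singleton'.mp h1
        rw [← hc, map_mul, hy, mul_zero]
      · simp [hp.coeff_natDegree]
      · rw [if_neg hi.ne', Polynomial.coeff_eq_zero_of_natDegree_lt hi, map_zero]
    rw [← Polynomial.eval₂_hom, ← Polynomial.eval_map, hmap, Polynomial.eval_pow,
      Polynomial.eval_X]
    exact pow_ne_zero _ hs
  · have := congrArg (fun f : Module.End R E ↦ f e) hzero
    rwa [Polynomial.aeval_algebraMap_apply, Module.algebraMap_end_apply,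
      Polynomial.coe_aeval_eq_eval] at this

/-! ### Annihilators of Ext from long exact sequences. -/

section

variable {R : Type u} [CommRing R]

/-- If `N' ≃ N / yN` with `y` regular on `N` and `Extⁱ⁺¹(N', M)` is killed by an element outside
the kernel of `χ`, where `χ y = 0`, then so is `Extⁱ(N, M)`. -/
lemma exists_smul_ext_eq_zero_of_surjective [IsNoetherianRing R] {F : Type*} [CommRing F]
    [IsDomain F] (χ : R →+* F) (N N' M : ModuleCat.{u} R) [Module.Finite R N] [Module.Finite R M]
    {y : R} (hy : χ y = 0) (hreg : IsSMulRegular N y) (g : N →ₗ[R] N')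
    (hg : Function.Surjective g) (hker : ∀ x, g x = 0 ↔ ∃ z, y • z = x) (i : ℕ)
    (h : ∃ s : R, χ s ≠ 0 ∧ ∀ e : Ext N' M (i + 1), s • e = 0) :
    ∃ s : R, χ s ≠ 0 ∧ ∀ e : Ext N M i, s • e = 0 := by
  obtain ⟨s, hs, hs0⟩ := h
  let S : ShortComplex (ModuleCat.{u} R) :=
    ShortComplex.mk (y • 𝟙 N) (ModuleCat.ofHom g) (by
      ext x
      exact (hker _).mpr ⟨x, rfl⟩)
  have hS : S.ShortExact := ModuleCat.shortComplex_shortExact S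
    (fun x ↦ (hker x).trans Iff.rfl) hreg hg
  refine exists_smul_eq_zero_of_smul_eq_smul χ hy hs fun e ↦ ?_
  -- The connecting map sends `s • e` into `Ext N' M (i + 1)`, where `s` kills it; by exactness `s •
  -- e` is a multiple of `y`.
  obtain ⟨e', he'⟩ := Ext.contravariant_sequence_exact₁ hS M (s • e) (add_comm 1 i) (by
    rw [Ext.comp_smul]
    exact hs0 _)
  refine ⟨e', he'.symm.trans ?_⟩
  change (Ext.mk₀ (y • 𝟙 N)).comp e' _ = _
  rw [Ext.mk₀_smul, Ext.smul_comp, Ext.mk₀_id_comp]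

/-- If `s` kills `Ext¹(R ⧸ P, M)` then `s` times any homomorphism `P → M` is multiplication by an
element of `M`. -/
lemma exists_smul_eq_smul_of_ext_eq_zero (P : Ideal R) (M : ModuleCat.{u} R) (s : R)
    (hs : ∀ e : Ext (ModuleCat.of R (R ⧸ P)) M 1, s • e = 0) (φ : P →ₗ[R] M) :
    ∃ m : M, ∀ p : P, s • φ p = (p : R) • m := by
  let S : ShortComplex (ModuleCat.{u} R) :=
    ShortComplex.mk (ModuleCat.ofHom P.subtype) (ModuleCat.ofHom P.mkQ) (by
      ext x
      exact Ideal.Quotient.eq_zero_iff_mem.mpr x.2)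
  have hS : S.ShortExact := ModuleCat.shortComplex_shortExact S
    (LinearMap.exact_subtype_mkQ P) P.injective_subtype P.mkQ_surjective
  obtain ⟨e, he⟩ := Ext.contravariant_sequence_exact₁ hS M (s • Ext.mk₀ (ModuleCat.ofHom φ))
    (add_zero 1) (by
      rw [Ext.comp_smul]
      exact hs _)
  obtain ⟨ψ, rfl⟩ := Ext.addEquiv₀.symm.surjective e
  change (Ext.mk₀ (ModuleCat.ofHom P.subtype)).comp (Ext.mk₀ ψ) _ = _ at he
  rw [Ext.mk₀_comp_mk₀, ← Ext.mk₀_smul] at he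
  have he := Ext.homEquiv₀.symm.injective he
  refine ⟨ψ.hom (1 : R), fun p ↦ ?_⟩
  have h1 := congrArg (fun f ↦ f.hom p) he
  change ψ.hom (p : R) = s • φ p at h1
  rw [← h1, ← map_smul, smul_eq_mul, mul_one]

end

/-! ### Ischebeck's theorem and the depth bound from a disconnection. -/

section

variable {K : Type u} [Field K] {σ : Type v}

lemma mem_span_X_image_of_X_mul_mem {s : Set σ} {i : σ} (hi : i ∉ s) {p : MvPolynomial σ K}
    (h : X i * p ∈ Ideal.span (X '' s : Set (MvPolynomial σ K))) :
    p ∈ Ideal.span (X '' s : Set (MvPolynomial σ K)) := by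
  rw [mem_ideal_span_X_image] at h ⊢
  intro m hm
  obtain ⟨j, hj, hmj⟩ := h (Finsupp.single i 1 + m) (by
    rw [mem_support_iff, coeff_X_mul]
    exact mem_support_iff.mp hm)
  refine ⟨j, hj, ?_⟩
  have hij : i ≠ j := fun hij ↦ hi (hij ▸ hj)
  simpa [Finsupp.single_apply, hij] using hmj

lemma mem_gradedMaximalIdeal_iff {p : MvPolynomial σ K} :
    p ∈ gradedMaximalIdeal K σ ↔ constantCoeff p = 0 := by
  rw [gradedMaximalIdeal, ← Set.image_univ, mem_ideal_span_X_image, constantCoeff_eq]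
  constructor
  · intro h
    by_contra h0
    obtain ⟨i, -, hi⟩ := h 0 (mem_support_iff.mpr h0)
    exact hi rfl
  · intro h m hm
    by_contra! hm0
    have : m = 0 := Finsupp.ext fun i ↦ hm0 i trivial
    exact mem_support_iff.mp hm (this ▸ h)

variable [Finite σ]

/-- A form of Ischebeck's theorem for the quotients of a polynomial ring by ideals generated by
variables. -/
lemma exists_smul_ext_quotient_span_X_eq_zero (M : ModuleCat.{max u v} (MvPolynomial σ K))
    [Module.Finite (MvPolynomial σ K) M]
    (hM : gradedMaximalIdeal K σ • (⊤ : Submodule (MvPolynomial σ K) M) < ⊤)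
    (rs : List (MvPolynomial σ K)) (hrs : ∀ r ∈ rs, r ∈ gradedMaximalIdeal K σ)
    (hreg : RingTheory.Sequence.IsRegular M rs) (D : Finset σ) (i : ℕ)
    (hi : i + D.card < rs.length) :
    ∃ s : MvPolynomial σ K, constantCoeff s ≠ 0 ∧
      ∀ e : Ext (ModuleCat.of _ (MvPolynomial σ K ⧸
        Ideal.span (X '' (D : Set σ)ᶜ : Set (MvPolynomial σ K)))) M i, s • e = 0 := by
  classical
  induction D using Finset.induction_on generalizing i with
  | empty =>
    -- For `D = ∅` the quotient is the residue field, and this is Rees' vanishing of Ext below the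
    -- length of a regular sequence.
    have hsub := ModuleCat.subsingleton_ext_of_exists_isRegular (gradedMaximalIdeal K σ)
      (ModuleCat.of _ (MvPolynomial σ K ⧸
        Ideal.span (X '' ((∅ : Finset σ) : Set σ)ᶜ : Set (MvPolynomial σ K)))) (by
        rw [Module.support_eq_zeroLocus, Ideal.annihilator_quotient, Finset.coe_empty,
          Set.compl_empty, Set.image_univ]
        rfl) M hM rs hrs hreg i (by simpa using hi)
    exact ⟨1, by simp, fun e ↦ Subsingleton.elim _ _⟩
  | insert a D ha ih =>
    have hle : Ideal.span (X '' ((insert a D : Finset σ) : Set σ)ᶜ : Set (MvPolynomial σ K)) ≤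
        Ideal.span (X '' (D : Set σ)ᶜ) :=
      Ideal.span_mono (Set.image_mono (Set.compl_subset_compl.mpr (by simp)))
    -- Allowing `a` as a free variable makes `X a` regular on the quotient; dividing by it returns
    -- to `D`, with `i` raised by one.
    refine exists_smul_ext_eq_zero_of_surjective (y := X a) constantCoeff _ _ M
      (by simp) ?_ (Submodule.factor hle)
      (Submodule.factor_surjective hle) ?_ i (ih (i + 1) ?_)
    · rw [isSMulRegular_iff_right_eq_zero_of_smul]
      intro x hx
      obtain ⟨x, rfl⟩ := Submodule.mkQ_surjective _ x
      rw [← map_smul, Submodule.mkQ_apply, Submodule.Quotient.mk_eq_zero] at hx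
      rw [Submodule.mkQ_apply, Submodule.Quotient.mk_eq_zero]
      exact mem_span_X_image_of_X_mul_mem (by simp) hx
    · intro x
      obtain ⟨x, rfl⟩ := Submodule.mkQ_surjective _ x
      have hc : (D : Set σ)ᶜ = insert a ((insert a D : Finset σ) : Set σ)ᶜ := by
        ext j
        by_cases hj : j = a <;> simp [hj, ha]
      have hmem : Submodule.factor hle (Submodule.mkQ _ x) = 0 ↔
          x ∈ Ideal.span (X '' (D : Set σ)ᶜ : Set (MvPolynomial σ K)) := by
        exact Submodule.Quotient.mk_eq_zero _
      rw [hmem, hc, Set.image_insert_eq, Ideal.mem_span_insert]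
      constructor
      · rintro ⟨c, z, hz, rfl⟩
        refine ⟨Submodule.mkQ _ c, ?_⟩
        rw [← map_smul, ← sub_eq_zero, ← map_sub, Submodule.mkQ_apply,
          Submodule.Quotient.mk_eq_zero, smul_eq_mul, mul_comm c, sub_add_cancel_left]
        exact neg_mem hz
      · rintro ⟨z, hz⟩
        obtain ⟨z, rfl⟩ := Submodule.mkQ_surjective _ z
        rw [← map_smul, ← sub_eq_zero, ← map_sub, Submodule.mkQ_apply,
          Submodule.Quotient.mk_eq_zero] at hz
        exact ⟨z, _, neg_mem hz, by simp [mul_comm]⟩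
    · rw [Finset.card_insert_of_notMem ha] at hi
      omega

/-- Let the variables outside `D` be split into `U` and `V`. If a monomial is sent into `J` by
every product of a variable of `U` and a variable of `V`, but there are variables in `U` and in
`V` whose products with the monomial do not occur in elements of `J`, then the depth of the
quotient by `J` is at most `|D| + 1`. -/
lemma polyDepth_quotient_le_card_add_one (J : Ideal (MvPolynomial σ K)) (D : Finset σ)
    (U V : Set σ) (hUV : Disjoint U V) (hD : (D : Set σ)ᶜ = U ∪ V) (e : σ →₀ ℕ)
    (hJ : ∀ u ∈ U, ∀ v ∈ V, (X u * X v * monomial e 1 : MvPolynomial σ K) ∈ J)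
    {u v : σ} (hu : u ∈ U) (hv : v ∈ V)
    (hu0 : ∀ p ∈ J, coeff (Finsupp.single u 1 + e) p = 0)
    (hv0 : ∀ p ∈ J, coeff (Finsupp.single v 1 + e) p = 0) :
    polyDepth K σ (MvPolynomial σ K ⧸ J) ≤ ((D.card + 1 : ℕ) : ℕ∞) := by
  classical
  rw [polyDepth, depthIn]
  refine iSup₂_le fun rs hrs ↦ ?_
  obtain ⟨hrs, hreg⟩ := hrs
  rw [Nat.cast_le]
  by_contra! hlt
  have hJm : J ≤ gradedMaximalIdeal K σ := by
    intro p hp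
    -- The coefficient of this product at the same exponent is the constant term of `p`.
    have := hu0 _ (J.mul_mem_right (monomial (Finsupp.single u 1 + e) 1) hp)
    rw [mem_gradedMaximalIdeal_iff, constantCoeff_eq]
    simpa [coeff_mul_monomial'] using this
  have hM : gradedMaximalIdeal K σ • (⊤ : Submodule (MvPolynomial σ K) (MvPolynomial σ K ⧸ J)) <
      ⊤ := by
    refine Ne.lt_top fun h ↦ ?_
    have h1 := congrArg (Submodule.comap J.mkQ) h
    rw [Submodule.comap_smul_top_of_surjective _ _ (Submodule.mkQ_surjective _),
      Submodule.ker_mkQ, Submodule.comap_top, smul_eq_mul, Ideal.mul_top, sup_eq_left.mpr hJm,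
      Ideal.eq_top_iff_one, mem_gradedMaximalIdeal_iff, map_one] at h1
    exact one_ne_zero h1
  obtain ⟨s, hs, hs0⟩ := exists_smul_ext_quotient_span_X_eq_zero
    (ModuleCat.of _ (MvPolynomial σ K ⧸ J)) hM rs hrs hreg D 1 (by omega)
  set A : Ideal (MvPolynomial σ K) := Ideal.span (X '' U) with hA
  set B : Ideal (MvPolynomial σ K) := Ideal.span (X '' V) with hB
  have hAB : ∀ p ∈ A, p ∈ B → p * monomial e 1 ∈ J := by
    intro p hpA hpB
    rw [hA, mem_ideal_span_X_image] at hpA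
    rw [hB, mem_ideal_span_X_image] at hpB
    rw [p.as_sum, Finset.sum_mul]
    refine J.sum_mem fun m hm ↦ ?_
    obtain ⟨a, ha, hma⟩ := hpA m hm
    obtain ⟨b, hb, hmb⟩ := hpB m hm
    have hab : a ≠ b := hUV.ne_of_mem ha hb
    have hle : Finsupp.single a 1 + Finsupp.single b 1 ≤ m := by
      intro j
      rw [Finsupp.add_apply, Finsupp.single_apply, Finsupp.single_apply]
      split_ifs with h1 h2 h2
      · exact absurd (h1.trans h2.symm) hab
      · subst h1; omega
      · subst h2; omega
      · omega
    have : (monomial m (coeff m p) : MvPolynomial σ K) =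
        monomial (m - (Finsupp.single a 1 + Finsupp.single b 1)) (coeff m p) * (X a * X b) := by
      rw [X, X, monomial_mul, monomial_mul, tsub_add_cancel_of_le hle, mul_one, mul_one]
    rw [this, mul_assoc]
    exact J.mul_mem_left _ (hJ a ha b hb)
  -- `f` and `g` agree on `A ⊓ B` by `hAB`, so they glue to a map on `A ⊔ B`.
  let f : MvPolynomial σ K →ₗ.[MvPolynomial σ K] (MvPolynomial σ K ⧸ J) :=
    ⟨A, (J.mkQ ∘ₗ LinearMap.mulRight _ (monomial e 1)) ∘ₗ A.subtype⟩
  let g : MvPolynomial σ K →ₗ.[MvPolynomial σ K] (MvPolynomial σ K ⧸ J) := ⟨B, 0⟩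
  have hfg : ∀ (x : f.domain) (y : g.domain), (x : MvPolynomial σ K) = y → f x = g y := by
    rintro ⟨x, hx⟩ ⟨y, hy⟩ rfl
    exact (Submodule.Quotient.mk_eq_zero J).mpr (hAB x hx hy)
  have hdom : (f.sup g hfg).domain = Ideal.span (X '' (D : Set σ)ᶜ) := by
    rw [LinearPMap.domain_sup, hD, Set.image_union, Ideal.span_union]
  obtain ⟨m, hm⟩ : ∃ m : MvPolynomial σ K ⧸ J,
      ∀ p : (f.sup g hfg).domain, s • f.sup g hfg p = (p : MvPolynomial σ K) • m := by
    rw [← hdom] at hs0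
    exact exists_smul_eq_smul_of_ext_eq_zero _ (ModuleCat.of _ (MvPolynomial σ K ⧸ J)) s hs0
      (f.sup g hfg).toFun
  obtain ⟨m, rfl⟩ := J.mkQ_surjective m
  have hXu : (X u : MvPolynomial σ K) ∈ A := Ideal.subset_span ⟨u, hu, rfl⟩
  have hXv : (X v : MvPolynomial σ K) ∈ B := Ideal.subset_span ⟨v, hv, rfl⟩
  have h1 : s * (X u * monomial e 1) - X u * m ∈ J := by
    have h := hm ⟨X u, (f.left_le_sup g hfg).1 hXu⟩
    rw [← (f.left_le_sup g hfg).2 (x := ⟨X u, hXu⟩) rfl] at h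
    exact (Submodule.Quotient.eq J).mp h
  have h2 : X v * m ∈ J := by
    have h := hm ⟨X v, (f.right_le_sup g hfg).1 hXv⟩
    rw [← (f.right_le_sup g hfg).2 (x := ⟨X v, hXv⟩) rfl] at h
    exact (Submodule.Quotient.mk_eq_zero J).mp (h.symm.trans (smul_zero s))
  -- `h2` kills the coefficient of `m` at `e`; `h1` then equates the constant term of `s` with zero.
  have h1 := hu0 _ h1
  have h2 := hv0 _ h2
  rw [coeff_X_mul] at h2
  rw [coeff_sub, coeff_X_mul, h2, sub_zero, mul_left_comm, coeff_X_mul] at h1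
  exact hs (by simpa [coeff_mul_monomial', constantCoeff_eq] using h1)

end

/-! ### Weights as an obstruction to membership in powers. -/

section

variable {K : Type*} [Field K] {σ : Type*}

lemma coeff_eq_zero_of_mem_pow {I : Ideal (MvPolynomial σ K)} (w : σ → ℕ) {d : ℕ}
    (hI : I ≤ Ideal.span ((fun m ↦ monomial m 1) '' {m | d ≤ Finsupp.weight w m})) (k : ℕ)
    {p : MvPolynomial σ K} (hp : p ∈ I ^ k) {m : σ →₀ ℕ} (hm : Finsupp.weight w m < d * k) :
    coeff m p = 0 := by
  have hpow : I ^ k ≤ Ideal.span ((fun m ↦ monomial m 1) '' {m | d * k ≤ Finsupp.weight w m}) := by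
    clear hp hm
    induction k with
    | zero =>
      refine le_top.trans_eq ((Ideal.eq_top_iff_one _).mpr ?_).symm
      exact Ideal.subset_span ⟨0, by simp, by simp⟩
    | succ k ih =>
      rw [pow_succ]
      refine (Ideal.mul_mono ih hI).trans ?_
      rw [Ideal.span_mul_span', Ideal.span_le]
      rintro _ ⟨_, ⟨a, ha, rfl⟩, _, ⟨b, hb, rfl⟩, rfl⟩
      refine Ideal.subset_span ⟨a + b, ?_, by simp [monomial_mul]⟩
      simp only [Set.mem_ofPred_eq, map_add] at ha hb ⊢
      linarith
  by_contra h0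
  obtain ⟨a, ha, ham⟩ := mem_ideal_span_monomial_image.mp (hpow hp) m (mem_support_iff.mpr h0)
  obtain ⟨b, rfl⟩ := le_iff_exists_add.mp ham
  simp only [Set.mem_ofPred_eq, map_add] at ha hm
  omega

end

/-! ### Growing a 2-coloured tree and its monomial. -/

section

variable {V : Type*}

/-- The vertices of the whisker graph that lie in `B` or are adjacent to a vertex of `A`. -/
def whiskerLink (G : SimpleGraph V) (A B : Finset V) : Set (V ⊕ V) :=
  {u | (∃ i ∈ A, (whiskerGraph G).Adj (.inl i) u) ∨ ∃ j ∈ B, u = .inl j}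

/-- The monomial with exponent `e`, of degree `2k` in the variables of `A ∪ B`, lies in the `k`-th
power of the edge ideal of the whisker graph, and it is sent into the power `k + 1` by the products of a variable from
`whiskerLink G A B` and a variable from `whiskerLink G B A`. -/
structure IsLinkMonomial (K : Type*) [Field K] (G : SimpleGraph V) (k : ℕ) (A B : Finset V)
    (e : V ⊕ V →₀ ℕ) : Prop where
  disjoint : Disjoint A B
  card : A.card + B.card = k + 1
  degree : e.degree = 2 * k
  exists_of_ne_zero : ∀ v, e v ≠ 0 → ∃ i, (i ∈ A ∨ i ∈ B) ∧ v = .inl i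
  monomial_mem_pow : (monomial e 1 : MvPolynomial (V ⊕ V) K) ∈ edgeIdeal K (whiskerGraph G) ^ k
  mem_pow : ∀ u ∈ whiskerLink G A B, ∀ w ∈ whiskerLink G B A,
    (X u * X w * monomial e 1 : MvPolynomial (V ⊕ V) K) ∈ edgeIdeal K (whiskerGraph G) ^ (k + 1)

variable {K : Type*} [Field K] {G : SimpleGraph V} {k : ℕ} {A B : Finset V} {e : V ⊕ V →₀ ℕ}

lemma X_mul_X_mem_edgeIdeal {W : Type*} {H : SimpleGraph W} {i j : W} (h : H.Adj i j) :
    (X i * X j : MvPolynomial W K) ∈ edgeIdeal K H :=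
  Ideal.subset_span ⟨i, j, h, rfl⟩

lemma IsLinkMonomial.symm (h : IsLinkMonomial K G k A B e) : IsLinkMonomial K G k B A e where
  disjoint := h.disjoint.symm
  card := (add_comm _ _).trans h.card
  degree := h.degree
  exists_of_ne_zero v hv := by
    obtain ⟨i, hi, rfl⟩ := h.exists_of_ne_zero v hv
    exact ⟨i, hi.symm, rfl⟩
  monomial_mem_pow := h.monomial_mem_pow
  mem_pow u hu w hw := by
    rw [mul_comm (X u)]
    exact h.mem_pow w hw u hu

lemma isLinkMonomial_singleton (G : SimpleGraph V) (i : V) :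
    IsLinkMonomial K G 0 {i} ∅ 0 where
  disjoint := by simp
  card := by simp
  degree := by simp
  exists_of_ne_zero := by simp
  monomial_mem_pow := by simp
  mem_pow := by
    rintro u (⟨_, h, hu⟩ | ⟨_, h, -⟩) w (⟨_, h', -⟩ | ⟨_, h', rfl⟩)
    · simp at h'
    · rw [Finset.mem_singleton] at h h'
      subst h h'
      simpa using X_mul_X_mem_edgeIdeal hu.symm
    · simp at h
    · simp at h

lemma monomial_add_single_add_single {σ : Type*} (e : σ →₀ ℕ) (i j : σ) :
    (monomial (e + (Finsupp.single i 1 + Finsupp.single j 1)) 1 : MvPolynomial σ K) =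
      X i * X j * monomial e 1 := by
  rw [X, X, monomial_mul, monomial_mul, add_comm e, mul_one, mul_one]

/-- The new vertex `v` is already in the link of `A` through `t`, so only the other link grows, by
the neighbours `w` of `v`. For these the factors are regrouped: `x_v x_w` is an edge, and `x_u x_t`
is an admissible pair for the old monomial. -/
lemma IsLinkMonomial.insert [DecidableEq V] (h : IsLinkMonomial K G k A B e) {t v : V}
    (ht : t ∈ A) (hvA : v ∉ A) (hvB : v ∉ B) (hadj : G.Adj t v) :
    IsLinkMonomial K G (k + 1) A (insert v B)
      (e + (Finsupp.single (.inl t) 1 + Finsupp.single (.inl v) 1)) where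
  disjoint := Finset.disjoint_insert_right.mpr ⟨hvA, h.disjoint⟩
  card := by rw [Finset.card_insert_of_notMem hvB, ← add_assoc, h.card]
  degree := by
    rw [map_add, map_add, h.degree, Finsupp.degree_single, Finsupp.degree_single]
    ring
  exists_of_ne_zero w hw := by
    by_cases hew : e w = 0
    · by_cases hwt : w = .inl t
      · exact ⟨t, .inl ht, hwt⟩
      · by_cases hwv : w = .inl v
        · exact ⟨v, .inr (by simp), hwv⟩
        · simp [hew, Ne.symm hwt, Ne.symm hwv] at hw
    · obtain ⟨i, hi, rfl⟩ := h.exists_of_ne_zero w hew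
      exact ⟨i, hi.imp_right (Finset.mem_insert_of_mem), rfl⟩
  monomial_mem_pow := by
    rw [monomial_add_single_add_single, pow_succ']
    exact Ideal.mul_mem_mul (X_mul_X_mem_edgeIdeal
      (show (whiskerGraph G).Adj (.inl t) (.inl v) from hadj)) h.monomial_mem_pow
  mem_pow u hu w hw := by
    have hu' : u ∈ whiskerLink G A B := by
      rcases hu with hu | ⟨j, hj, rfl⟩
      · exact .inl hu
      · rcases Finset.mem_insert.mp hj with rfl | hj
        · exact .inl ⟨t, ht, hadj⟩
        · exact .inr ⟨j, hj, rfl⟩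
    have hcases : w ∈ whiskerLink G B A ∨ (whiskerGraph G).Adj (.inl v) w := by
      rcases hw with ⟨i, hi, hiw⟩ | hw
      · rcases Finset.mem_insert.mp hi with rfl | hi
        · exact .inr hiw
        · exact .inl (.inl ⟨i, hi, hiw⟩)
      · exact .inl (.inr hw)
    rw [monomial_add_single_add_single, pow_succ' _ (k + 1)]
    rcases hcases with hw' | hw'
    · have hmem := Ideal.mul_mem_mul
        (X_mul_X_mem_edgeIdeal (K := K) (show (whiskerGraph G).Adj (.inl t) (.inl v) from hadj))
        (h.mem_pow u hu' w hw')
      convert hmem using 1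
      ring
    · have hmem := Ideal.mul_mem_mul (X_mul_X_mem_edgeIdeal (K := K) hw')
        (h.mem_pow u hu' (.inl t) (.inr ⟨t, ht, rfl⟩))
      convert hmem using 1
      ring

lemma exists_isLinkMonomial (K : Type*) [Field K] [Fintype V] (hG : G.Connected) (k : ℕ)
    (hk : k < Fintype.card V) : ∃ A B e, IsLinkMonomial K G k A B e := by
  classical
  induction k with
  | zero =>
    obtain ⟨i⟩ := hG.nonempty
    exact ⟨_, _, _, isLinkMonomial_singleton G i⟩
  | succ k ih =>
    obtain ⟨A, B, e, h⟩ := ih (by omega)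
    have hcard : (A ∪ B).card = k + 1 := by rw [Finset.card_union_of_disjoint h.disjoint, h.card]
    obtain ⟨a, ha⟩ : (A ∪ B).Nonempty := Finset.card_pos.mp (by omega)
    obtain ⟨b, hb⟩ : ∃ b, b ∉ A ∪ B := by
      by_contra! hall
      rw [Finset.eq_univ_of_forall hall, Finset.card_univ] at hcard
      omega
    obtain ⟨p⟩ := hG.preconnected a b
    -- A walk leaving `A ∪ B` crosses an edge to a new vertex, which gets the colour opposite to its
    -- neighbour.
    obtain ⟨d, -, hd, hd'⟩ := p.exists_boundary_dart ((A ∪ B : Finset V) : Set V) ha hb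
    simp only [Finset.coe_union, Set.mem_union, Finset.mem_coe, not_or] at hd hd'
    rcases hd with hd | hd
    · exact ⟨_, _, _, h.insert hd hd'.1 hd'.2 d.adj⟩
    · exact ⟨_, _, _, h.symm.insert hd hd'.2 hd'.1 d.adj⟩

end

/-! ### The depth bound for the whisker graph. -/

section

variable {V : Type*} [DecidableEq V]

/-- The weight on the vertices of the whisker graph that is `1` over `T`, and `2` on the vertices
and `0` on the whisker ends outside `T`. -/
def whiskerWeight (T : Finset V) : V ⊕ V → ℕ
  | .inl i => if i ∈ T then 1 else 2
  | .inr i => if i ∈ T then 1 else 0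

lemma edgeIdeal_whiskerGraph_le_span_weight (K : Type*) [Field K] (G : SimpleGraph V)
    (T : Finset V) :
    edgeIdeal K (whiskerGraph G) ≤
      Ideal.span ((fun m ↦ monomial m 1) '' {m | 2 ≤ Finsupp.weight (whiskerWeight T) m}) := by
  rw [edgeIdeal, Ideal.span_le]
  rintro _ ⟨i, j, hij, rfl⟩
  refine Ideal.subset_span ⟨Finsupp.single i 1 + Finsupp.single j 1, ?_, ?_⟩
  · rw [Set.mem_ofPred_eq, map_add, Finsupp.weight_single, Finsupp.weight_single, one_smul, one_smul]
    rcases i with i | i <;> rcases j with j | j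
    · simp only [whiskerWeight]
      split_ifs <;> omega
    · obtain rfl : i = j := hij
      simp only [whiskerWeight]
      split_ifs <;> omega
    · obtain rfl : i = j := hij
      simp only [whiskerWeight]
      split_ifs <;> omega
    · exact hij.elim
  · simp [X, monomial_mul]

variable {K : Type*} [Field K] {G : SimpleGraph V} {k : ℕ} {A B : Finset V} {e : V ⊕ V →₀ ℕ}

lemma IsLinkMonomial.weight_eq (h : IsLinkMonomial K G k A B e) :
    Finsupp.weight (whiskerWeight (A ∪ B)) e = 2 * k := by
  rw [← h.degree, Finsupp.weight_apply, Finsupp.degree_apply, Finsupp.sum]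
  refine Finset.sum_congr rfl fun v hv ↦ ?_
  obtain ⟨i, hi, rfl⟩ := h.exists_of_ne_zero v (Finsupp.mem_support_iff.mp hv)
  simp [whiskerWeight, hi]

lemma IsLinkMonomial.polyDepth_le [Fintype V] (h : IsLinkMonomial K G k A B e) :
    polyDepth K (V ⊕ V) (MvPolynomial (V ⊕ V) K ⧸ edgeIdeal K (whiskerGraph G) ^ (k + 1)) ≤
      ((Fintype.card V - (k + 1) + 1 : ℕ) : ℕ∞) := by
  have hcard : (((A ∪ B)ᶜ).map Function.Embedding.inr : Finset (V ⊕ V)).card = Fintype.card V - (k + 1) := by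
    rw [Finset.card_map, Finset.card_compl, Finset.card_union_of_disjoint h.disjoint, h.card]
  have hAB := Finset.disjoint_left.mp h.disjoint
  -- The whisker ends outside `A ∪ B` have weight zero, so `f` costs nothing in the weight bound; it
  -- serves to absorb the vertices outside `A ∪ B`.
  set f : V ⊕ V →₀ ℕ := ∑ j ∈ (A ∪ B)ᶜ, Finsupp.single (.inr j) 1 with hf
  have hf0 : Finsupp.weight (whiskerWeight (A ∪ B)) f = 0 := by
    rw [hf, map_sum]
    refine Finset.sum_eq_zero fun j hj ↦ ?_
    rw [Finset.mem_compl] at hj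
    simp [Finsupp.weight_single, whiskerWeight, hj]
  have hcoeff : ∀ v, whiskerWeight (A ∪ B) v = 1 →
      ∀ p ∈ edgeIdeal K (whiskerGraph G) ^ (k + 1),
        coeff (Finsupp.single v 1 + (f + e)) p = 0 := by
    intro v hv p hp
    refine coeff_eq_zero_of_mem_pow _ (edgeIdeal_whiskerGraph_le_span_weight K G (A ∪ B)) _ hp ?_
    -- The weight is `1 + 0 + 2 * k`, one short of the `2 * (k + 1)` required in the power `k + 1`.
    rw [map_add, map_add, hf0, h.weight_eq, Finsupp.weight_single, hv]
    simp only [smul_eq_mul]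
    omega
  have hmul : (monomial (f + e) 1 : MvPolynomial (V ⊕ V) K) = monomial f 1 * monomial e 1 := by
    rw [monomial_mul, mul_one]
  obtain ⟨u, hu, v, hv, hu1, hv1⟩ :
      ∃ u ∈ (Sum.inr '' (A : Set V) ∪ Sum.inl '' (B : Set V) : Set (V ⊕ V)),
      ∃ v ∈ (Sum.inr '' (B : Set V) ∪ Sum.inl '' ((B : Set V)ᶜ) : Set (V ⊕ V)),
      whiskerWeight (A ∪ B) u = 1 ∧ whiskerWeight (A ∪ B) v = 1 := by
    obtain ⟨i, hi⟩ : (A ∪ B).Nonempty := Finset.card_pos.mp (by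
      rw [Finset.card_union_of_disjoint h.disjoint, h.card]
      omega)
    have hl : whiskerWeight (A ∪ B) (.inl i) = 1 := if_pos hi
    have hr : whiskerWeight (A ∪ B) (.inr i) = 1 := if_pos hi
    rcases Finset.mem_union.mp hi with hi | hi
    · exact ⟨.inr i, .inl ⟨i, hi, rfl⟩, .inl i, .inr ⟨i, hAB hi, rfl⟩, hr, hl⟩
    · exact ⟨.inl i, .inr ⟨i, hi, rfl⟩, .inr i, .inl ⟨i, hi, rfl⟩, hl, hr⟩
  rw [← hcard]
  refine polyDepth_quotient_le_card_add_one _ _ _ _ ?_ ?_ (f + e) ?_ hu hv (hcoeff u hu1)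
    (hcoeff v hv1)
  · rw [Set.disjoint_left]
    rintro _ (⟨i, hi, rfl⟩ | ⟨i, hi, rfl⟩) (⟨j, hj, hij⟩ | ⟨j, hj, hij⟩)
    · exact hAB hi (Sum.inr_injective hij ▸ hj)
    · cases hij
    · cases hij
    · exact hj (Sum.inl_injective hij ▸ hi)
  · ext (i | i)
    · simp [em]
    · simpa using or_iff_not_imp_left.symm
  · rw [hmul]
    intro u hu v hv
    have hu' : u ∈ whiskerLink G A B := by
      rcases hu with ⟨i, hi, rfl⟩ | ⟨i, hi, rfl⟩
      · exact .inl ⟨i, hi, rfl⟩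
      · exact .inr ⟨i, hi, rfl⟩
    have hv' : v ∈ whiskerLink G B A ∨ ∃ j ∈ (A ∪ B)ᶜ, v = .inl j := by
      rcases hv with ⟨j, hj, rfl⟩ | ⟨j, hj, rfl⟩
      · exact .inl (.inl ⟨j, hj, rfl⟩)
      · by_cases hjA : j ∈ A
        · exact .inl (.inr ⟨j, hjA, rfl⟩)
        · exact .inr ⟨j, by simpa [hjA] using hj, rfl⟩
    rcases hv' with hv' | ⟨j, hj, rfl⟩
    · rw [mul_left_comm]
      exact Ideal.mul_mem_left _ _ (h.mem_pow u hu' v hv')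
    -- Here `x_j` pairs with the factor `y_j` of `f` to form a whisker, the extra edge needed
    -- besides the `k` in `e`.
    · have hfj : (monomial f 1 : MvPolynomial (V ⊕ V) K) =
          X (.inr j) * monomial (∑ i ∈ (A ∪ B)ᶜ.erase j, Finsupp.single (.inr i) 1) 1 := by
        rw [X, monomial_mul, mul_one, hf, ← Finset.add_sum_erase _ _ hj]
      have hmem := Ideal.mul_mem_mul (X_mul_X_mem_edgeIdeal (K := K)
        (show (whiskerGraph G).Adj (.inl j) (.inr j) from rfl)) h.monomial_mem_pow
      rw [← pow_succ'] at hmem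
      rw [hfj]
      convert Ideal.mul_mem_left _ (X u * monomial (∑ i ∈ (A ∪ B)ᶜ.erase j,
        Finsupp.single (.inr i) 1) 1) hmem using 1
      ring

end

theorem theorem2p2 {K : Type*} [Field K] {n : ℕ} (G : SimpleGraph (Fin n)) (hG : G.Connected)
    (k : ℕ) (hk : 1 ≤ k) (hkn : k ≤ n) :
    polyDepth K (Fin n ⊕ Fin n)
        (MvPolynomial (Fin n ⊕ Fin n) K ⧸ (edgeIdeal K (whiskerGraph G)) ^ k) ≤
      ((n - k + 1 : ℕ) : ℕ∞) := by
  obtain ⟨k, rfl⟩ := Nat.exists_eq_add_of_le' hk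
  obtain ⟨A, B, e, h⟩ := exists_isLinkMonomial K hG k (by simpa using hkn)
  simpa using h.polyDepth_le
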